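/- All graphs are finite and simple; $|G|$ denotes the number of vertices of $G$. A graph $G$ is $\varepsilon$-sparse if every vertex has degree less than $\varepsilon|G|$. Two disjoint sets of vertices are anticomplete if there is no edge between them. $G$ is $(\alpha,\beta)$-coherent if there do not exist disjoint anticomplete sets $A,B\subseteq V(G)$ with $|A|\ge\alpha$ and $|B|\ge\beta$. A levelling in $G$ is a sequence $\mathcal L=(L_0,\ldots,L_k)$ of pairwise disjoint subsets of $V(G)$ with $k\ge 1$ such that $|L_0|=1$; for $1\le i\le k$ every vertex of $L_i$ has a neighbour in $L_{i-1}$; and for $2\le i\le k$ there is no edge between $L_0\cup\cdots\cup L_{i-2}$ and $L_i$. Its height is $k$, its apex is the vertex of $L_0$, its base is $L_k$, its penultimate level is $L_{k-1}$, its heart is $L_0\cup\cdots\cup L_{k-1}$, and $V(\mathcal L)=L_0\cup\cdots\cup L_k$. A lobster of length $n\ge 1$ in $G$ consists of a vertex $a$ (its apex) and levellings $\mathcal L_1,\ldots,\mathcal L_n$ in $G$ (its members), all with apex $a$ and with hearts $H_1,\ldots,H_n$, such that $H_1\setminus\{a\},\ldots,H_n\setminus\{a\}$ are pairwise disjoint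 and, for all distinct $i,j$, every edge $uv$ of $G$ with $u\in H_i\setminus\{a\}$ and $v\in V(\mathcal L_j)\setminus\{a\}$ has $u$ in the penultimate level of $\mathcal L_i$ and $v$ in the base of $\mathcal L_j$. Its height is the maximum of the heights of its members, its mass is the minimum cardinality of the bases of its members, and its heart is $H_1\cup\cdots\cup H_n$. A troupe of $m$ lobsters is a set $\{\mathcal T_1,\ldots,\mathcal T_m\}$ of $m$ lobsters such that (i) for $1\le i<j\le m$, the hearts of $\mathcal T_i$ and $\mathcal T_j$ are disjoint and anticomplete; and (ii) whenever $\mathcal L=(L_0,\ldots,L_k)$ and $\mathcal M$ are different members of lobsters among $\mathcal T_1,\ldots,\mathcal T_m$ (possibly of the same lobster), there is no edge between $L_0\cup\cdots\cup L_{k-2}$ and the base of $\mathcal M$. Theorem. Let $c>0$ be such that $1/c$ is an integer, let $m,n\ge 1$ be integers, and let $\varepsilon$ be given by $$\varepsilon^{-1}=\bigl(2^{2^{2n}}+3(m-1)n\bigr)\,(2+2/c)^{mn}.$$ If $G$ is an $\varepsilon$-sparse $(\varepsilon|G|^{1-c},\varepsilon|G|)$-coherent graph with $|G|>1$, then $G$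 contains a troupe of $m$ lobsters, each of length $n$, of height at most $2+2/c$, and of mass at least $\varepsilon|G|$. -/

import Mathlib

namespace PurePairs

variable {V : Type*}

/-- No edge of `G` joins a vertex of `A` to a vertex of `B` (disjointness of anticomplete sets is
always stated separately below). -/
def Anticomplete (G : SimpleGraph V) (A B : Set V) : Prop :=
  ∀ a ∈ A, ∀ b ∈ B, ¬ G.Adj a b

/-- Every vertex of `B` has a neighbour in `A`. -/
def Covers (G : SimpleGraph V) (A B : Set V) : Prop :=
  ∀ b ∈ B, ∃ a ∈ A, G.Adj a b

/-- `G` is `ε`-sparse: every vertex has degree less than `ε |G|`. -/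
def IsSparse (G : SimpleGraph V) (ε : ℝ) : Prop :=
  ∀ v : V, ((G.neighborSet v).ncard : ℝ) < ε * (Nat.card V : ℝ)

/-- `G` is `(α, β)`-coherent: there are no disjoint anticomplete sets `A`, `B` of vertices with
`|A| ≥ α` and `|B| ≥ β`. -/
def IsCoherent (G : SimpleGraph V) (α β : ℝ) : Prop :=
  ¬ ∃ A B : Set V, Disjoint A B ∧ Anticomplete G A B ∧
    α ≤ (A.ncard : ℝ) ∧ β ≤ (B.ncard : ℝ)

/-- A levelling `(L_0, …, L_k)` in `G`, with `k = height ≥ 1` and `L_0 = {apex}`. The finite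
sequence is stored as a function on `ℕ` that is empty beyond `k`. -/
structure Levelling (G : SimpleGraph V) where
  height : ℕ
  one_le_height : 1 ≤ height
  apex : V
  level : ℕ → Set V
  level_of_height_lt : ∀ i, height < i → level i = ∅
  level_zero : level 0 = {apex}
  level_disjoint : ∀ i j, i ≠ j → Disjoint (level i) (level j)
  level_covers : ∀ i, i < height → Covers G (level i) (level (i + 1))
  level_anticomplete : ∀ i j, i + 2 ≤ j → j ≤ height → Anticomplete G (level i) (level j)

namespace Levelling

variable {G : SimpleGraph V}

/-- `L_0 ∪ ⋯ ∪ L_k`. -/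
def vertexSet (L : Levelling G) : Set V := {v | ∃ i, i ≤ L.height ∧ v ∈ L.level i}

/-- The base `L_k`. -/
def base (L : Levelling G) : Set V := L.level L.height

/-- The heart `L_0 ∪ ⋯ ∪ L_{k-1}`. -/
def heart (L : Levelling G) : Set V := L.vertexSet \ L.base

/-- The penultimate level `L_{k-1}` (recall that `k ≥ 1`). -/
def penultimate (L : Levelling G) : Set V := L.level (L.height - 1)

/-- `L_0 ∪ ⋯ ∪ L_{k-2}`; it is empty when `k = 1`. -/
def inner (L : Levelling G) : Set V := {v | ∃ i, i + 2 ≤ L.height ∧ v ∈ L.level i}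

end Levelling

/-- A lobster of length `n ≥ 1` in `G`. -/
structure Lobster (G : SimpleGraph V) (n : ℕ) where
  one_le_length : 1 ≤ n
  apex : V
  member : Fin n → Levelling G
  member_apex : ∀ i, (member i).apex = apex
  heart_disjoint : ∀ i j, i ≠ j →
    Disjoint ((member i).heart \ {apex}) ((member j).heart \ {apex})
  edge_condition : ∀ i j, i ≠ j →
    ∀ u ∈ (member i).heart \ {apex}, ∀ v ∈ (member j).vertexSet \ {apex},
      G.Adj u v → u ∈ (member i).penultimate ∧ v ∈ (member j).base

namespace Lobster

variable {G : SimpleGraph V} {n : ℕ}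

/-- The maximum of the heights of the members. -/
def height (T : Lobster G n) : ℕ := Finset.univ.sup fun i => (T.member i).height

/-- The minimum of the cardinalities of the bases of the members (there is at least one member). -/
noncomputable def mass (T : Lobster G n) : ℕ := ⨅ i, (T.member i).base.ncard

/-- The union of the hearts of the members. -/
def heart (T : Lobster G n) : Set V := ⋃ i, (T.member i).heart

end Lobster

/-- `T_1, …, T_m` form a troupe of `m` lobsters of length `n`. (They are then distinct, since their
hearts are nonempty and pairwise disjoint.) The second condition ranges over all pairs of members
with different indices. -/
structure IsTroupe {G : SimpleGraph V} {m n : ℕ} (T : Fin m → Lobster G n) : Prop where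
  heart_disjoint : ∀ i j, i ≠ j → Disjoint (T i).heart (T j).heart
  heart_anticomplete : ∀ i j, i ≠ j → Anticomplete G (T i).heart (T j).heart
  inner_anticomplete : ∀ (i j : Fin m) (p q : Fin n), (i, p) ≠ (j, q) →
    Anticomplete G ((T i).member p).inner ((T j).member q).base

end PurePairs

/-!
Write `e = ε|G|` and `α = ε|G|^(1-c)`, so that `e / α = |G|^c`. Coherence says that a set with at
least `α` vertices has all but fewer than `e` vertices of the graph in its closed neighbourhood, and
it forces balls to grow: in a set of at least `3e` vertices some ball of radius `r = ⌊1/c⌋` has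
at least `α` vertices.

Cut a large set into `2^n` parts, and repeatedly sacrifice the part `X_i` covered by the fewest
connected sets: a connected subset of `X_i`, grown until it covers half of another part `X_k`, is
added to the sets covering `X_k`, and all remaining parts are halved so that it has no neighbour in
the parts other than `X_k`. The sum of `2^f`, with `f` the number of sets covering a part, does not
decrease, so the last part is covered by `n` pairwise anticomplete connected sets of radius `r`. Any
of its vertices is adjacent to all of them, and is the apex of `n` sets of radius `2r + 1` that are
otherwise anticomplete. Doing this `m` times, each time away from the sets found before, gives `mn`
sets `K_t`, each with a large set `D_t` of neighbours.

Classify the vertices of each `D_s` by the distances at which they attach to all the `K_t`, and keep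
a most common class `C_s`. The levelling for `K_t` is breadth-first search in `K_t`, and its base is
the class `C_s` attaching to `K_t` at the smallest distance, so that no base has an edge to an inner
level. Discarding the neighbours of the apices leaves at most `2r + 2 ≤ 2 + 2/c` possible distances.
-/

namespace PurePairs

section Cardinality

variable {V : Type*} {A B : Set V}

theorem cast_ncard_le [Finite V] (h : A ⊆ B) : (A.ncard : ℝ) ≤ B.ncard :=
  Nat.cast_le.2 (Set.ncard_le_ncard h)

theorem cast_ncard_union_le (A B : Set V) : ((A ∪ B).ncard : ℝ) ≤ A.ncard + B.ncard := by
  exact_mod_cast Set.ncard_union_le A B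

theorem cast_ncard_sdiff_add_ncard_inter [Finite V] (A B : Set V) :
    ((A \ B).ncard : ℝ) + (B ∩ A).ncard = A.ncard := by
  rw [add_comm, Set.inter_comm]
  exact_mod_cast Set.ncard_inter_add_ncard_sdiff_eq_ncard A B

theorem cast_ncard_iUnion_le {ι : Type*} [Fintype ι] {s : ι → Set V} {b : ℝ}
    (h : ∀ i, ((s i).ncard : ℝ) ≤ b) : ((⋃ i, s i).ncard : ℝ) ≤ Fintype.card ι * b :=
  calc ((⋃ i, s i).ncard : ℝ) ≤ ∑ i, ((s i).ncard : ℝ) := by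
        exact_mod_cast Set.ncard_iUnion_le_of_fintype s
    _ ≤ ∑ _i : ι, b := Finset.sum_le_sum fun i _ => h i
    _ = Fintype.card ι * b := by simp

theorem cast_ncard_sub_le_cast_ncard_sdiff [Finite V] (A B : Set V) :
    (A.ncard : ℝ) - B.ncard ≤ (A \ B).ncard := by
  linarith [cast_ncard_sdiff_add_ncard_inter A B, cast_ncard_le (Set.inter_subset_left (s := B)
    (t := A))]

theorem nonempty_embedding_of_card_le_ncard {ι : Type*} [Fintype ι] [Finite A]
    (h : Fintype.card ι ≤ A.ncard) : Nonempty (ι ↪ A) := by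
  have := Fintype.ofFinite A
  exact Function.Embedding.nonempty_of_card_le (by rwa [Fintype.card_eq_nat_card (α := A)])

theorem exists_disjoint_subsets_of_mul_le_ncard [Finite V] {s t : ℕ} (hA : s * t ≤ A.ncard) :
    ∃ X : Fin s → Set V, (∀ j, X j ⊆ A) ∧ Pairwise (fun i j => Disjoint (X i) (X j)) ∧
      ∀ j, (X j).ncard = t := by
  obtain ⟨f⟩ := nonempty_embedding_of_card_le_ncard (ι := Fin s × Fin t) (A := A) (by simpa)
  have hf : Function.Injective fun p => (f p : V) := Subtype.val_injective.comp f.injective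
  refine ⟨fun j => Set.range fun i => (f (j, i) : V), ?_, ?_, fun j => ?_⟩
  · rintro j _ ⟨i, rfl⟩
    exact (f (j, i)).2
  · refine fun i j hij => Set.disjoint_left.2 ?_
    rintro _ ⟨a, rfl⟩ ⟨b, hb⟩
    exact hij (Prod.ext_iff.1 (hf hb)).1.symm
  · have hfj : Function.Injective fun i => (f (j, i) : V) := hf.comp (Prod.mk_right_injective j)
    exact (Set.ncard_range_of_injective hfj).trans (Nat.card_fin t)

theorem exists_le_ncard_fiber [Finite V] {β : Type*} {f : V → β} {s : Finset β} {e : ℝ}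
    (hs : s.Nonempty) (hf : ∀ x ∈ A, f x ∈ s) (hA : s.card * e ≤ A.ncard) :
    ∃ b, e ≤ (A ∩ f ⁻¹' {b}).ncard := by
  classical
  have hfin := Set.toFinite A
  obtain ⟨b, -, hb⟩ := Finset.exists_le_card_fiber_of_nsmul_le_card_of_maps_to
    (s := hfin.toFinset) (t := s) (f := f) (b := e) (by simpa) hs
    (by rwa [nsmul_eq_mul, ← Set.ncard_eq_toFinset_card A hfin])
  refine ⟨b, hb.trans_eq ?_⟩
  rw [← Set.ncard_coe_finset]
  congr 2
  ext x
  simp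

end Cardinality

section Neighbourhood

variable {V : Type*} {G : SimpleGraph V} {A A' B B' H X : Set V}

/-- The set of vertices with a neighbour in `H`, including those that are in `H` themselves. -/
def nbhd (G : SimpleGraph V) (H : Set V) : Set V := {x | ∃ y ∈ H, G.Adj y x}

/-- The union of `H` with the set of vertices having a neighbour in `H`. -/
def closedNbhd (G : SimpleGraph V) (H : Set V) : Set V := H ∪ nbhd G H

/-- `A` and `B` are disjoint and anticomplete, which is the hypothesis of coherence. -/
def Separated (G : SimpleGraph V) (A B : Set V) : Prop := Disjoint A B ∧ Anticomplete G A B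

@[simp]
theorem nbhd_empty : nbhd G ∅ = ∅ := by simp [nbhd]

@[simp]
theorem closedNbhd_empty : closedNbhd G ∅ = ∅ := by simp [closedNbhd]

theorem nbhd_mono (h : A ⊆ B) : nbhd G A ⊆ nbhd G B := fun _ ⟨y, hy, hyx⟩ => ⟨y, h hy, hyx⟩

theorem nbhd_range {κ : Type*} (a : κ → V) : nbhd G (Set.range a) = ⋃ i, G.neighborSet (a i) := by
  ext x
  simp [nbhd]

theorem nbhd_subset_union_neighborSet (x : V) :
    nbhd G H ⊆ nbhd G (H \ {x}) ∪ G.neighborSet x := by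
  rintro z ⟨y, hy, hyz⟩
  by_cases hyx : y = x
  · exact Or.inr (hyx ▸ hyz)
  · exact Or.inl ⟨y, ⟨hy, hyx⟩, hyz⟩

theorem closedNbhd_subset_union_neighborSet (x : V) :
    closedNbhd G H ⊆ closedNbhd G (H \ {x}) ∪ (G.neighborSet x ∪ {x}) := by
  have hH : H ⊆ H \ {x} ∪ {x} := by simp
  have hN := nbhd_subset_union_neighborSet (G := G) (H := H) x
  unfold closedNbhd
  grind

theorem separated_iff_disjoint_closedNbhd : Separated G A B ↔ Disjoint (closedNbhd G A) B := by
  simp only [Separated, Anticomplete, closedNbhd, nbhd, Set.disjoint_union_left,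
    and_congr_right_iff]
  intro _
  rw [Set.disjoint_left]
  grind

theorem separated_sdiff_closedNbhd : Separated G A (X \ closedNbhd G A) :=
  separated_iff_disjoint_closedNbhd.2 Set.disjoint_sdiff_right

theorem Separated.symm (h : Separated G A B) : Separated G B A :=
  ⟨h.1.symm, fun b hb a ha hba => h.2 a ha b hb hba.symm⟩

theorem Separated.mono (h : Separated G A B) (hA : A' ⊆ A) (hB : B' ⊆ B) : Separated G A' B' :=
  ⟨h.1.mono hA hB, fun a ha b hb => h.2 a (hA ha) b (hB hb)⟩

end Neighbourhood

section Ball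

variable {V : Type*} {G : SimpleGraph V} {H H' X : Set V} {a v x y : V} {i j r : ℕ}

/-- The ball of radius `r` about `a` in the subgraph induced on `H ∪ {a}`. -/
def ball (G : SimpleGraph V) (H : Set V) (a : V) : ℕ → Set V
  | 0 => {a}
  | r + 1 => ball G H a r ∪ H ∩ nbhd G (ball G H a r)

/-- `H` is connected and every vertex of `H` is within distance `r` of `a ∈ H` in the subgraph
induced on `H`. -/
structure HasRadiusLE (G : SimpleGraph V) (r : ℕ) (a : V) (H : Set V) : Prop where
  center_mem : a ∈ H
  subset_ball : H ⊆ ball G H a r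

theorem mem_ball_succ :
    x ∈ ball G H a (i + 1) ↔ x ∈ ball G H a i ∨ x ∈ H ∧ ∃ y ∈ ball G H a i, G.Adj y x :=
  Iff.rfl

theorem ball_mono (h : i ≤ j) : ball G H a i ⊆ ball G H a j :=
  monotone_nat_of_le_succ (f := ball G H a) (fun _ => Set.subset_union_left) h

theorem ball_mono_set (h : H ⊆ H') : ball G H a i ⊆ ball G H' a i := by
  induction i with
  | zero => exact subset_rfl
  | succ i ih => exact Set.union_subset_union ih (Set.inter_subset_inter h (nbhd_mono ih))

theorem mem_ball_self : a ∈ ball G H a i := ball_mono (Nat.zero_le i) rfl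

theorem ball_subset (ha : a ∈ H) : ball G H a i ⊆ H := by
  induction i with
  | zero => rintro x rfl; exact ha
  | succ i ih => exact Set.union_subset ih Set.inter_subset_left

theorem ball_subset_of_ball_subset (h : ball G H a i ⊆ X) : ball G H a i ⊆ ball G X a i := by
  induction i with
  | zero => exact subset_rfl
  | succ i ih =>
    have hi := ih ((ball_mono i.le_succ).trans h)
    exact Set.union_subset (hi.trans (ball_mono i.le_succ)) fun x hx =>
      Or.inr ⟨h (Or.inr hx), nbhd_mono hi hx.2⟩

theorem ball_trans (hy : y ∈ ball G H a i) (hx : x ∈ ball G H y j) :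
    x ∈ ball G H a (i + j) := by
  induction j generalizing x with
  | zero => obtain rfl : x = y := hx; exact hy
  | succ j ih =>
    rcases mem_ball_succ.1 hx with hx | ⟨hxH, z, hz, hzx⟩
    · exact Or.inl (ih hx)
    · exact Or.inr ⟨hxH, z, ih hz, hzx⟩

theorem mem_ball_one (hx : x ∈ H) (hax : G.Adj a x) : x ∈ ball G H a 1 := Or.inr ⟨hx, a, rfl, hax⟩

theorem mem_ball_comm (ha : a ∈ H) (hx : x ∈ ball G H a i) : a ∈ ball G H x i := by
  induction i generalizing x with
  | zero => exact (show x = a from hx).symm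
  | succ i ih =>
    rcases mem_ball_succ.1 hx with hx | ⟨_, y, hy, hyx⟩
    · exact Or.inl (ih hx)
    · rw [Nat.add_comm]
      exact ball_trans (mem_ball_one (ball_subset ha hy) hyx.symm) (ih hy)

theorem hasRadiusLE_ball : HasRadiusLE G r v (ball G X v r) :=
  ⟨mem_ball_self, ball_subset_of_ball_subset subset_rfl⟩

theorem HasRadiusLE.insert_of_adj (h : HasRadiusLE G r v H) (hx : x ∈ H) (hax : G.Adj a x) :
    HasRadiusLE G (2 * r + 1) a (insert a H) := by
  refine ⟨Set.mem_insert a H, Set.insert_subset mem_ball_self fun y hy => ?_⟩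
  have hsub := Set.subset_insert a H
  have hax' : x ∈ ball G (insert a H) a 1 := mem_ball_one (hsub hx) hax
  have hxv : v ∈ ball G (insert a H) x r :=
    ball_mono_set hsub (mem_ball_comm h.center_mem (h.subset_ball hx))
  have hvy : y ∈ ball G (insert a H) v r := ball_mono_set hsub (h.subset_ball hy)
  exact ball_mono (by omega) (ball_trans (ball_trans hax' hxv) hvy)

/-- A vertex `x` farthest from the centre can be removed. -/
theorem HasRadiusLE.exists_sdiff_singleton (h : HasRadiusLE G r a H) (hne : H ≠ {a}) :
    ∃ x ∈ H, HasRadiusLE G r a (H \ {x}) := by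
  classical
  have hex : ∃ t, H ⊆ ball G H a t := ⟨r, h.subset_ball⟩
  obtain ⟨t, ht⟩ : ∃ t, Nat.find hex = t := ⟨_, rfl⟩
  have hsub : H ⊆ ball G H a t := ht ▸ Nat.find_spec hex
  have htr : t ≤ r := ht ▸ Nat.find_min' hex h.subset_ball
  cases t with
  | zero => exact absurd (hsub.antisymm (Set.singleton_subset_iff.2 h.center_mem)) hne
  | succ t =>
    obtain ⟨x, hxH, hx⟩ := Set.not_subset.1 (Nat.find_min hex (m := t) (by omega))
    have hball : ball G H a t ⊆ ball G (H \ {x}) a t :=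
      ball_subset_of_ball_subset fun y hy => ⟨ball_subset h.center_mem hy, fun hyx => hx (hyx ▸ hy)⟩
    refine ⟨x, hxH, ⟨h.center_mem, fun hax => hx (hax ▸ mem_ball_self)⟩, ?_⟩
    rintro y ⟨hyH, hyx⟩
    refine ball_mono htr ?_
    rcases mem_ball_succ.1 (hsub hyH) with hy | ⟨_, z, hz, hzy⟩
    · exact Or.inl (hball hy)
    · exact Or.inr ⟨⟨hyH, hyx⟩, z, hball hz, hzy⟩

theorem HasRadiusLE.exists_critical_subset [Finite V] (h : HasRadiusLE G r a H)
    {P : Set V → Prop} (hP0 : ¬ P ∅) (hP : P H) :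
    ∃ K ⊆ H, HasRadiusLE G r a K ∧ P K ∧ ∃ x ∈ K, ¬ P (K \ {x}) := by
  obtain ⟨K, hKH, ⟨hK, hPK⟩, hmin⟩ :=
    Finite.exists_le_minimal (p := fun K => HasRadiusLE G r a K ∧ P K) ⟨h, hP⟩
  refine ⟨K, hKH, hK, hPK, ?_⟩
  by_cases hne : K = {a}
  · exact ⟨a, hK.center_mem, by simpa [hne] using hP0⟩
  · obtain ⟨x, hxK, hx⟩ := hK.exists_sdiff_singleton hne
    exact ⟨x, hxK, fun hPx => (hmin ⟨hx, hPx⟩ Set.sdiff_subset hxK).2 rfl⟩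

end Ball

section Growth

variable {V : Type*} {G : SimpleGraph V} {α e q : ℝ} {r : ℕ} {A X : Set V} {v : V}

/-- Sparsity and coherence with absolute bounds in place of multiples of the number of vertices:
every degree is less than `e`, and a set separated from a set of at least `α` vertices has fewer
than `e` vertices. -/
structure IsSparseCoherent (G : SimpleGraph V) (α e : ℝ) : Prop where
  pos : 0 < α
  le : α ≤ e
  ncard_neighborSet_lt : ∀ v, ((G.neighborSet v).ncard : ℝ) < e
  ncard_lt_of_separated : ∀ A B : Set V, Separated G A B → α ≤ A.ncard → (B.ncard : ℝ) < e

theorem exists_slow_extension [Finite V] (hq : 0 ≤ q) (hv : v ∈ X \ A)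
    (hr : ((ball G X v r).ncard : ℝ) < q ^ r) :
    ∃ S ⊆ X \ A, v ∈ S ∧ S ⊆ ball G X v r ∧
      ((closedNbhd G (A ∪ S) ∩ X).ncard : ℝ) ≤ (closedNbhd G A ∩ X).ncard + q * S.ncard := by
  have hball : ∀ i, ball G (X \ A) v i ⊆ ball G X v i := fun i => ball_mono_set Set.sdiff_subset
  obtain ⟨i, hir, hi⟩ : ∃ i < r,
      ((ball G (X \ A) v (i + 1)).ncard : ℝ) < q * (ball G (X \ A) v i).ncard := by
    by_contra! hfast
    have hgeom := geom_le (u := fun i => ((ball G (X \ A) v i).ncard : ℝ)) hq r hfast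
    simp only [ball, Set.ncard_singleton, Nat.cast_one, mul_one] at hgeom
    linarith [cast_ncard_le (hball r)]
  refine ⟨ball G (X \ A) v i, ball_subset hv, mem_ball_self,
    (ball_mono hir.le).trans (hball r), ?_⟩
  have hsub : closedNbhd G (A ∪ ball G (X \ A) v i) ∩ X ⊆
      (closedNbhd G A ∩ X) ∪ ball G (X \ A) v (i + 1) := by
    rintro x ⟨(hx | hx) | ⟨y, hy | hy, hyx⟩, hxX⟩
    · exact Or.inl ⟨Or.inl hx, hxX⟩
    · exact Or.inr (Or.inl hx)
    · exact Or.inl ⟨Or.inr ⟨y, hy, hyx⟩, hxX⟩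
    · by_cases hxA : x ∈ A
      · exact Or.inl ⟨Or.inl hxA, hxX⟩
      · exact Or.inr (Or.inr ⟨⟨hxX, hxA⟩, y, hy, hyx⟩)
  linarith [(cast_ncard_le hsub).trans (cast_ncard_union_le _ _)]

namespace IsSparseCoherent

theorem ncard_nbhd_range_le {κ : Type*} [Fintype κ] (h : IsSparseCoherent G α e) (a : κ → V) :
    ((nbhd G (Set.range a)).ncard : ℝ) ≤ Fintype.card κ * e := by
  rw [nbhd_range]
  exact cast_ncard_iUnion_le fun i => (h.ncard_neighborSet_lt (a i)).le

variable [Finite V]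

theorem one_le [Nontrivial V] (h : IsSparseCoherent G α e) : 1 ≤ e := by
  by_contra! he
  have hnbr : ∀ v, G.neighborSet v = ∅ := fun v => by
    rw [← Set.ncard_eq_zero, ← Nat.lt_one_iff]
    exact_mod_cast (h.ncard_neighborSet_lt v).trans he
  obtain ⟨v, w, hvw⟩ := exists_pair_ne V
  have hsep : Separated G {v} {w} := ⟨by simpa using hvw, by
    rintro a - b - hab
    exact (hnbr a).le hab⟩
  have hw := h.ncard_lt_of_separated {v} {w} hsep (by simpa using h.le.trans he.le)
  rw [Set.ncard_singleton, Nat.cast_one] at hw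
  linarith

theorem ncard_lt_ncard_closedNbhd_inter_add (h : IsSparseCoherent G α e) (hA : α ≤ A.ncard)
    (X : Set V) : (X.ncard : ℝ) < (closedNbhd G A ∩ X).ncard + e := by
  rw [← cast_ncard_sdiff_add_ncard_inter X (closedNbhd G A)]
  linarith [h.ncard_lt_of_separated A (X \ closedNbhd G A) separated_sdiff_closedNbhd hA]

theorem ncard_nbhd_inter_le (h : IsSparseCoherent G α e) (H Y : Set V) (x : V) :
    ((nbhd G H ∩ Y).ncard : ℝ) ≤ (nbhd G (H \ {x}) ∩ Y).ncard + e := by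
  have hsub : nbhd G H ∩ Y ⊆ (nbhd G (H \ {x}) ∩ Y) ∪ G.neighborSet x := by
    grind [nbhd_subset_union_neighborSet (G := G) (H := H) x]
  linarith [(cast_ncard_le hsub).trans (cast_ncard_union_le _ _), h.ncard_neighborSet_lt x]

theorem ncard_closedNbhd_inter_le (h : IsSparseCoherent G α e) (H Y : Set V) (x : V) :
    ((closedNbhd G H ∩ Y).ncard : ℝ) ≤ (closedNbhd G (H \ {x}) ∩ Y).ncard + (e + 1) := by
  have hsub : closedNbhd G H ∩ Y ⊆
      (closedNbhd G (H \ {x}) ∩ Y) ∪ (G.neighborSet x ∪ {x}) := by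
    grind [closedNbhd_subset_union_neighborSet (G := G) (H := H) x]
  have hx := cast_ncard_union_le (G.neighborSet x) {x}
  rw [Set.ncard_singleton, Nat.cast_one] at hx
  linarith [(cast_ncard_le hsub).trans (cast_ncard_union_le _ _), h.ncard_neighborSet_lt x]

theorem one_lt (h : IsSparseCoherent G α e) (he : 1 ≤ e) (hV : 3 * e ≤ Nat.card V) : 1 < α := by
  by_contra! hα
  have hpos : (0 : ℝ) < Nat.card V := by linarith
  obtain ⟨v⟩ := Finite.card_pos_iff.1 (Nat.cast_pos.1 hpos)
  have hlt := h.ncard_lt_ncard_closedNbhd_inter_add (A := {v}) (by simpa using hα) Set.univ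
  have hle := h.ncard_closedNbhd_inter_le {v} Set.univ v
  simp only [Set.sdiff_self, closedNbhd_empty, Set.empty_inter,
    Set.ncard_empty, Set.ncard_univ, Nat.cast_zero] at hlt hle
  linarith

/-- If all balls of radius `r` are small, then a maximal set `A` of fewer than `α` vertices with
`|N[A] ∩ X| ≤ (e / α) |A|` can be extended by some ball, to a set of at least `α` vertices that is
too far from dominating `X`. -/
theorem exists_large_ball (h : IsSparseCoherent G α e) (hr : α ≤ (e / α) ^ r)
    (hX : 3 * e ≤ X.ncard) : ∃ v ∈ X, α ≤ (ball G X v r).ncard := by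
  by_contra! hsmall
  have hq : e / α * α = e := div_mul_cancel₀ e h.pos.ne'
  have hq0 : 0 ≤ e / α := div_nonneg (h.pos.le.trans h.le) h.pos.le
  obtain ⟨A, -, ⟨hAX, hAα, hAq⟩, hmax⟩ := Finite.exists_le_maximal
    (p := fun A : Set V => A ⊆ X ∧ (A.ncard : ℝ) < α ∧
      ((closedNbhd G A ∩ X).ncard : ℝ) ≤ e / α * A.ncard)
    (a := ∅) ⟨Set.empty_subset X, by simpa using h.pos, by simp⟩
  obtain ⟨v, hvX, hvA⟩ : ∃ v ∈ X, v ∉ A := Set.not_subset.1 fun hXA => by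
    linarith [cast_ncard_le hXA, h.le, h.pos]
  obtain ⟨S, hSX, hvS, hSball, hS⟩ :=
    exists_slow_extension (G := G) (r := r) hq0 ⟨hvX, hvA⟩ ((hsmall v hvX).trans_le hr)
  have hSα : (S.ncard : ℝ) < α := (cast_ncard_le hSball).trans_lt (hsmall v hvX)
  have hcard : ((A ∪ S).ncard : ℝ) = A.ncard + S.ncard := by
    exact_mod_cast Set.ncard_union_eq (Set.disjoint_left.2 fun x hxA hxS => (hSX hxS).2 hxA)
  have hslow : ((closedNbhd G (A ∪ S) ∩ X).ncard : ℝ) ≤ e / α * (A ∪ S).ncard := by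
    rw [hcard, mul_add]
    linarith
  rcases lt_or_ge ((A ∪ S).ncard : ℝ) α with hlt | hge
  · exact hvA (hmax ⟨Set.union_subset hAX (hSX.trans Set.sdiff_subset), hlt, hslow⟩
      Set.subset_union_left (Or.inr hvS))
  · have hle : e / α * ((A ∪ S).ncard : ℝ) ≤ e / α * (2 * α) :=
      mul_le_mul_of_nonneg_left (by linarith) hq0
    linarith [h.ncard_lt_ncard_closedNbhd_inter_add hge X]

theorem exists_half_cover (h : IsSparseCoherent G α e) (hr : α ≤ (e / α) ^ r)
    (hX : 3 * e ≤ X.ncard) {ι : Type*} {J : Finset ι} (hJ : J.Nonempty) {Y : ι → Set V}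
    (hXY : ∀ j ∈ J, Disjoint X (Y j)) (hY : ∀ j ∈ J, 2 * e ≤ (Y j).ncard) :
    ∃ H ⊆ X, (∃ v, HasRadiusLE G r v H) ∧
      (∃ k ∈ J, ((Y k).ncard : ℝ) / 2 ≤ (nbhd G H ∩ Y k).ncard) ∧
      ∀ j ∈ J, ((nbhd G H ∩ Y j).ncard : ℝ) ≤ (Y j).ncard / 2 + e := by
  obtain ⟨v, hv, hball⟩ := h.exists_large_ball hr hX
  have hempty : ¬ ∃ k ∈ J, ((Y k).ncard : ℝ) / 2 ≤ (nbhd G ∅ ∩ Y k).ncard := by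
    rintro ⟨k, hk, hle⟩
    simp only [nbhd_empty, Set.empty_inter, Set.ncard_empty, Nat.cast_zero] at hle
    linarith [hY k hk, h.pos, h.le]
  have hcover : ∃ k ∈ J, ((Y k).ncard : ℝ) / 2 ≤ (nbhd G (ball G X v r) ∩ Y k).ncard := by
    obtain ⟨k, hk⟩ := hJ
    have hdisj : Disjoint (ball G X v r) (Y k) := (hXY k hk).mono_left (ball_subset hv)
    have hlt := h.ncard_lt_ncard_closedNbhd_inter_add hball (Y k)
    rw [closedNbhd, Set.union_inter_distrib_right, hdisj.inter_eq, Set.empty_union] at hlt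
    exact ⟨k, hk, by linarith [hY k hk]⟩
  obtain ⟨H, hHX, hHr, hH, x, -, hx⟩ := hasRadiusLE_ball.exists_critical_subset
    (P := fun H => ∃ k ∈ J, ((Y k).ncard : ℝ) / 2 ≤ (nbhd G H ∩ Y k).ncard) hempty hcover
  refine ⟨H, hHX.trans (ball_subset hv), ⟨v, hHr⟩, hH, fun j hj => ?_⟩
  push Not at hx
  linarith [hx j hj, h.ncard_nbhd_inter_le H (Y j) x]

end IsSparseCoherent

end Growth

section CoveringFamily

variable {V : Type*} {G : SimpleGraph V} {w : ℝ} {r : ℕ} {Z H X X' : Set V} {F : Set (Set V)}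

/-- Pairwise separated connected subsets of `Z` of radius at most `r`, each covering `X` and having
at least `w` neighbours in `Z`. -/
structure CoveringFamily (G : SimpleGraph V) (Z : Set V) (r : ℕ) (w : ℝ) (X : Set V)
    (F : Set (Set V)) : Prop where
  base_subset : X ⊆ Z
  subset : ∀ H ∈ F, H ⊆ Z
  radius : ∀ H ∈ F, ∃ v, HasRadiusLE G r v H
  large : ∀ H ∈ F, w ≤ (nbhd G H ∩ Z).ncard
  covers : ∀ H ∈ F, X ⊆ nbhd G H
  pairwise : F.Pairwise (Separated G)

theorem CoveringFamily.mono (h : CoveringFamily G Z r w X F) (hX : X' ⊆ X) :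
    CoveringFamily G Z r w X' F :=
  { h with
    base_subset := hX.trans h.base_subset
    covers := fun H hH => hX.trans (h.covers H hH) }

theorem CoveringFamily.insert (h : CoveringFamily G Z r w X F) (hZ : H ⊆ Z)
    (hr : ∃ v, HasRadiusLE G r v H) (hw : w ≤ (nbhd G H ∩ Z).ncard) (hX : X ⊆ nbhd G H)
    (hF : ∀ H' ∈ F, Separated G H' H) : CoveringFamily G Z r w X (insert H F) where
  base_subset := h.base_subset
  subset := Set.forall_mem_insert.2 ⟨hZ, h.subset⟩
  radius := Set.forall_mem_insert.2 ⟨hr, h.radius⟩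
  large := Set.forall_mem_insert.2 ⟨hw, h.large⟩
  covers := Set.forall_mem_insert.2 ⟨hX, h.covers⟩
  pairwise := h.pairwise.insert fun H' hH' _ => ⟨(hF H' hH').symm, hF H' hH'⟩

end CoveringFamily

section CoveredParts

variable {V ι : Type*} {G : SimpleGraph V} {α e w W : ℝ} {r n t : ℕ} {Z H : Set V}
  {X : ι → Set V} {F : ι → Set (Set V)} {J : Finset ι} {i k : ι}

/-- Disjoint parts `X j`, for `j ∈ J`, with families `F j` of sets covering them, such that no set
in `F j` meets or has a neighbour in another part. -/
structure CoveredParts (G : SimpleGraph V) (Z : Set V) (r : ℕ) (w : ℝ) (J : Finset ι)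
    (X : ι → Set V) (F : ι → Set (Set V)) : Prop where
  covering : ∀ j ∈ J, CoveringFamily G Z r w (X j) (F j)
  disjoint : ∀ i ∈ J, ∀ j ∈ J, i ≠ j → Disjoint (X i) (X j)
  separated : ∀ i ∈ J, ∀ j ∈ J, i ≠ j → ∀ H ∈ F j, Separated G H (X i)

section Split

variable [DecidableEq ι]

/-- Shrinks the part `X k` to the set of its vertices with a neighbour in `H`, and every other part
to the set of its vertices without one. -/
def splitParts (G : SimpleGraph V) (H : Set V) (k : ι) (X : ι → Set V) : ι → Set V :=
  Function.update (fun j => X j \ nbhd G H) k (nbhd G H ∩ X k)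

theorem splitParts_self : splitParts G H k X k = nbhd G H ∩ X k := Function.update_self ..

theorem splitParts_of_ne {j : ι} (hj : j ≠ k) : splitParts G H k X j = X j \ nbhd G H :=
  Function.update_of_ne hj ..

theorem splitParts_subset (j : ι) : splitParts G H k X j ⊆ X j := by
  obtain rfl | hj := eq_or_ne j k
  · exact splitParts_self.subset.trans Set.inter_subset_right
  · exact (splitParts_of_ne hj).subset.trans Set.sdiff_subset

theorem CoveredParts.erase (h : CoveredParts G Z r w J X F) (hi : i ∈ J) (hk : k ∈ J.erase i)
    (hH : H ⊆ X i) (hr : ∃ v, HasRadiusLE G r v H) (hw : w ≤ (nbhd G H ∩ Z).ncard) :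
    CoveredParts G Z r w (J.erase i) (splitParts G H k X)
      (Function.update F k (insert H (F k))) where
  covering j hj := by
    obtain ⟨hji, hjJ⟩ := Finset.mem_erase.1 hj
    have hmono := (h.covering j hjJ).mono (splitParts_subset (G := G) (H := H) (k := k) j)
    obtain rfl | hjk := eq_or_ne j k
    · rw [Function.update_self]
      have hsep : ∀ H' ∈ F j, Separated G H' H := fun H' hH' =>
        (h.separated i hi j hjJ hji.symm H' hH').mono subset_rfl hH
      exact hmono.insert (hH.trans (h.covering i hi).base_subset) hr hw
        (splitParts_self.subset.trans Set.inter_subset_left) hsep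
    · rwa [Function.update_of_ne hjk]
  disjoint a ha b hb hab :=
    (h.disjoint a (Finset.mem_of_mem_erase ha) b (Finset.mem_of_mem_erase hb) hab).mono
      (splitParts_subset a) (splitParts_subset b)
  separated a ha b hb hab H' hH' := by
    have haJ := Finset.mem_of_mem_erase ha
    have hold : ∀ H' ∈ F b, Separated G H' (splitParts G H k X a) := fun H' hH' =>
      (h.separated a haJ b (Finset.mem_of_mem_erase hb) hab H' hH').mono subset_rfl
        (splitParts_subset a)
    obtain rfl | hbk := eq_or_ne b k
    · rw [Function.update_self] at hH'
      obtain rfl | hH' := hH'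
      · refine ⟨(h.disjoint i hi a haJ (Finset.ne_of_mem_erase ha).symm).mono hH
          (splitParts_subset a), fun x hx y hy hxy => ?_⟩
        rw [splitParts_of_ne hab] at hy
        exact hy.2 ⟨x, hx, hxy⟩
      · exact hold H' hH'
    · rw [Function.update_of_ne hbk] at hH'
      exact hold H' hH'

theorem sum_two_pow_le_sum_erase_update {f : ι → ℕ} (hi : i ∈ J) (hk : k ∈ J.erase i)
    (hik : f i ≤ f k) :
    ∑ j ∈ J, 2 ^ f j ≤ ∑ j ∈ J.erase i, 2 ^ Function.update f k (f k + 1) j := by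
  have hrest : ∑ j ∈ (J.erase i).erase k, 2 ^ Function.update f k (f k + 1) j =
      ∑ j ∈ (J.erase i).erase k, 2 ^ f j :=
    Finset.sum_congr rfl fun j hj => by rw [Function.update_of_ne (Finset.ne_of_mem_erase hj)]
  have hpow : 2 ^ f i ≤ 2 ^ f k := Nat.pow_le_pow_right two_pos hik
  rw [← Finset.add_sum_erase J _ hi, ← Finset.add_sum_erase (J.erase i) _ hk,
    ← Finset.add_sum_erase (J.erase i) _ hk, hrest, Function.update_self, pow_succ]
  omega

theorem IsSparseCoherent.exists_coveredParts_erase [Finite V] (h : IsSparseCoherent G α e)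
    (hr : α ≤ (e / α) ^ r) (hW : 2 * e ≤ W) (hX : CoveredParts G Z r (2 * W) J X F) (hi : i ∈ J)
    (hmin : ∀ j ∈ J, (F i).ncard ≤ (F j).ncard) (hJ : J.card = t + 2)
    (hsize : ∀ j ∈ J, 2 ^ (t + 3) * W - 2 * e ≤ (X j).ncard) :
    ∃ (X' : ι → Set V) (F' : ι → Set (Set V)), CoveredParts G Z r (2 * W) (J.erase i) X' F' ∧
      (∀ j ∈ J.erase i, 2 ^ (t + 2) * W - 2 * e ≤ (X' j).ncard) ∧
      ∑ j ∈ J, 2 ^ (F j).ncard ≤ ∑ j ∈ J.erase i, 2 ^ (F' j).ncard := by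
  have hpow : 4 * W ≤ 2 ^ (t + 2) * W := by
    have : (1 : ℝ) ≤ 2 ^ t := one_le_pow₀ one_le_two
    rw [pow_add]
    nlinarith [h.pos, h.le]
  replace hsize : ∀ j ∈ J, 2 * (2 ^ (t + 2) * W) - 2 * e ≤ (X j).ncard := fun j hj =>
    (hsize j hj).trans' (by rw [pow_succ _ (t + 2)]; linarith)
  have he := h.pos.trans_le h.le
  have hmem : ∀ {j}, j ∈ J.erase i → j ∈ J := Finset.mem_of_mem_erase
  obtain ⟨H, hHX, hHr, ⟨k, hk, hhalf⟩, hle⟩ := h.exists_half_cover hr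
    (J := J.erase i) (Y := X) (by linarith [hsize i hi])
    (Finset.card_pos.1 (by rw [Finset.card_erase_of_mem hi]; omega))
    (fun j hj => hX.disjoint i hi j (hmem hj) (Finset.ne_of_mem_erase hj).symm)
    (fun j hj => by linarith [hsize j (hmem hj)])
  have hlarge : 2 * W ≤ (nbhd G H ∩ Z).ncard := by
    have hsub := Set.inter_subset_inter_right (nbhd G H) (hX.covering k (hmem hk)).base_subset
    linarith [cast_ncard_le hsub, hsize k (hmem hk)]
  have hHF : H ∉ F k := fun hmemF => by
    have hsep := hX.separated i hi k (hmem hk) (Finset.ne_of_mem_erase hk).symm H hmemF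
    obtain ⟨v, hv⟩ := hHr
    exact Set.disjoint_left.1 hsep.1 hv.center_mem (hHX hv.center_mem)
  refine ⟨splitParts G H k X, Function.update F k (insert H (F k)),
    hX.erase hi hk hHX hHr hlarge, fun j hj => ?_, ?_⟩
  · have hj' := hsize j (hmem hj)
    obtain rfl | hjk := eq_or_ne j k
    · rw [splitParts_self]
      linarith
    · rw [splitParts_of_ne hjk]
      linarith [cast_ncard_sdiff_add_ncard_inter (X j) (nbhd G H), hle j hj]
  · convert sum_two_pow_le_sum_erase_update (f := fun j => (F j).ncard) hi hk
      (hmin k (hmem hk)) using 3 with j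
    obtain rfl | hjk := eq_or_ne j k
    · simp only [Function.update_self, Set.ncard_insert_of_notMem hHF]
    · simp only [Function.update_of_ne hjk]

end Split

theorem IsSparseCoherent.exists_coveringFamily_of_coveredParts [Finite V]
    (h : IsSparseCoherent G α e) (hr : α ≤ (e / α) ^ r) (hW : 2 * e ≤ W)
    (hX : CoveredParts G Z r (2 * W) J X F) (hJ : J.card = t + 1)
    (hsize : ∀ j ∈ J, 2 ^ (t + 2) * W - 2 * e ≤ (X j).ncard)
    (hsum : 2 ^ n ≤ ∑ j ∈ J, 2 ^ (F j).ncard) :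
    ∃ X F, X.Nonempty ∧ CoveringFamily G Z r (2 * W) X F ∧ n ≤ F.ncard := by
  classical
  induction t generalizing J X F with
  | zero =>
    obtain ⟨j, rfl⟩ := Finset.card_eq_one.1 hJ
    have hj := Finset.mem_singleton_self j
    refine ⟨X j, F j, ?_, hX.covering j hj, ?_⟩
    · have hpos : (0 : ℝ) < (X j).ncard := by
        have hsizej := hsize j hj
        norm_num at hsizej
        linarith [h.pos, h.le]
      exact Set.nonempty_of_ncard_ne_zero (Nat.cast_pos.1 hpos).ne'
    · rw [Finset.sum_singleton] at hsum
      exact (Nat.pow_le_pow_iff_right one_lt_two).1 hsum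
  | succ t ih =>
    obtain ⟨i, hi, hmin⟩ := Finset.exists_min_image J (fun j => (F j).ncard)
      (Finset.card_pos.1 (by omega))
    obtain ⟨X', F', hX', hsize', hsum'⟩ :=
      h.exists_coveredParts_erase hr hW hX hi hmin hJ hsize
    exact ih hX' (by rw [Finset.card_erase_of_mem hi, hJ]; rfl) hsize' (hsum.trans hsum')

theorem add_two_pow_le_two_pow_two_mul (hn : 1 ≤ n) : n + (2 ^ n + 1) ≤ 2 ^ (2 * n) := by
  induction n, hn using Nat.le_induction with
  | base => norm_num
  | succ n hn ih =>
    rw [show 2 * (n + 1) = 2 * n + 2 by ring, pow_add 2 (2 * n), pow_succ 2 n]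
    omega

theorem IsSparseCoherent.exists_coveringFamily [Finite V] (h : IsSparseCoherent G α e)
    (hr : α ≤ (e / α) ^ r) (he : 1 ≤ e) (hW : 2 * e ≤ W) (hn : 1 ≤ n)
    (hZ : 2 ^ 2 ^ (2 * n) * W ≤ Z.ncard) :
    ∃ X F, X.Nonempty ∧ CoveringFamily G Z r (2 * W) X F ∧ n ≤ F.ncard := by
  obtain ⟨b, hb⟩ : ∃ b : ℝ, b = 2 ^ (2 ^ n + 1) * W - 2 * e := ⟨_, rfl⟩
  have hb0 : 0 ≤ b := by
    have : (1 : ℝ) ≤ 2 ^ (2 ^ n + 1) := one_le_pow₀ one_le_two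
    nlinarith
  have hfit : (2 : ℝ) ^ n * ⌈b⌉₊ ≤ Z.ncard := calc
    (2 : ℝ) ^ n * ⌈b⌉₊ ≤ 2 ^ n * (2 ^ (2 ^ n + 1) * W) := by
        gcongr
        linarith [Nat.ceil_lt_add_one hb0]
    _ = 2 ^ (n + (2 ^ n + 1)) * W := by rw [pow_add 2 n, mul_assoc]
    _ ≤ 2 ^ 2 ^ (2 * n) * W := by
        gcongr
        · linarith
        · exact one_le_two
        · exact add_two_pow_le_two_pow_two_mul hn
    _ ≤ Z.ncard := hZ
  obtain ⟨X, hXZ, hX, hXb⟩ := exists_disjoint_subsets_of_mul_le_ncard (s := 2 ^ n) (t := ⌈b⌉₊)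
    (A := Z) (by exact_mod_cast hfit)
  have hparts : CoveredParts G Z r (2 * W) Finset.univ X fun _ => ∅ :=
    ⟨fun j _ => by constructor <;> simp [hXZ j], fun i _ j _ => @hX i j, by simp⟩
  obtain ⟨t, ht⟩ : ∃ t, 2 ^ n = t + 1 := Nat.exists_eq_add_one.2 (Nat.two_pow_pos n)
  refine h.exists_coveringFamily_of_coveredParts hr hW hparts (by simpa using ht) (fun j _ => ?_)
    (by simp)
  rw [hXb, show t + 2 = 2 ^ n + 1 by omega, ← hb]
  exact Nat.le_ceil b

end CoveredParts

section Skeleton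

variable {V ι κ : Type*} {G : SimpleGraph V} {α e W : ℝ} {r n m ρ : ℕ} {Z H : Set V} {a : V}

/-- Sets of radius at most `ρ` about a common vertex `a`, pairwise separated apart from `a`. They
will contain the hearts of the members of a lobster with apex `a`. -/
structure IsSkeleton (G : SimpleGraph V) (ρ : ℕ) (a : V) (K : ι → Set V) : Prop where
  radius : ∀ p, HasRadiusLE G ρ a (K p)
  separated : ∀ p p', p ≠ p' → Separated G (K p \ {a}) (K p' \ {a})

/-- Pairwise separated skeletons `K i`, together with a set `E i p` of neighbours of each member
`K i p` that avoids all the skeletons. -/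
structure SkeletonFamily (G : SimpleGraph V) (ρ : ℕ) (a : κ → V) (K E : κ → ι → Set V) :
    Prop where
  isSkeleton : ∀ i, IsSkeleton G ρ (a i) (K i)
  separated : ∀ i j, i ≠ j → ∀ p p', Separated G (K i p) (K j p')
  attached : ∀ i p, E i p ⊆ nbhd G (K i p)
  disjoint : ∀ i p j p', Disjoint (E i p) (K j p')

theorem IsSparseCoherent.exists_pruned_subset [Finite V] (h : IsSparseCoherent G α e)
    (he : 1 ≤ e) (hW : 2 * e ≤ W) (hZ : 3 * W ≤ Z.ncard) (hH : HasRadiusLE G ρ a H)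
    (hHZ : 2 * W ≤ (closedNbhd G H ∩ Z).ncard) :
    ∃ K ⊆ H, HasRadiusLE G ρ a K ∧ K.ncard ≤ 2 * e ∧ 2 * W ≤ (closedNbhd G K ∩ Z).ncard ∧
      (closedNbhd G K ∩ Z).ncard ≤ 3 * W := by
  have hempty : ¬ 2 * W ≤ ((closedNbhd G ∅ ∩ Z).ncard : ℝ) := by
    simp only [closedNbhd_empty, Set.empty_inter, Set.ncard_empty, Nat.cast_zero]
    linarith
  obtain ⟨K, hKH, hK, hKW, x, hxK, hx⟩ := hH.exists_critical_subset
    (P := fun K => 2 * W ≤ ((closedNbhd G K ∩ Z).ncard : ℝ)) hempty hHZ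
  have hsmall : ((K \ {x}).ncard : ℝ) < α := by
    by_contra! hα
    linarith [h.ncard_lt_ncard_closedNbhd_inter_add hα Z]
  have hcard : ((K \ {x}).ncard : ℝ) + 1 = K.ncard := by
    exact_mod_cast Set.ncard_sdiff_singleton_add_one hxK
  exact ⟨K, hKH, hK, by linarith [h.le], hKW, by linarith [h.ncard_closedNbhd_inter_le K Z x]⟩

theorem IsSparseCoherent.exists_isSkeleton [Finite V] (h : IsSparseCoherent G α e)
    (hr : α ≤ (e / α) ^ r) (he : 1 ≤ e) (hW : 2 * e ≤ W) (hn : 1 ≤ n)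
    (hZ : 2 ^ 2 ^ (2 * n) * W ≤ Z.ncard) :
    ∃ (a : V) (K : Fin n → Set V), IsSkeleton G (2 * r + 1) a K ∧ ∀ p, K p ⊆ Z ∧
      (K p).ncard ≤ 2 * e ∧ 2 * W ≤ (closedNbhd G (K p) ∩ Z).ncard ∧
      (closedNbhd G (K p) ∩ Z).ncard ≤ 3 * W := by
  obtain ⟨X, F, ⟨a, ha⟩, hF, hnF⟩ := h.exists_coveringFamily hr he hW hn hZ
  obtain ⟨H⟩ := nonempty_embedding_of_card_le_ncard (ι := Fin n) (A := F) (by simpa using hnF)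
  have hWZ : 3 * W ≤ Z.ncard := by
    have hpow : (2 : ℝ) ^ 2 ≤ 2 ^ 2 ^ (2 * n) :=
      pow_le_pow_right₀ one_le_two (Nat.le_self_pow (by omega) 2)
    nlinarith
  choose v hv using fun p => hF.radius (H p) (H p).2
  choose x hx hxa using fun p => hF.covers (H p) (H p).2 ha
  have hlarge : ∀ p, 2 * W ≤ (closedNbhd G (insert a (H p : Set V)) ∩ Z).ncard := fun p =>
    (hF.large _ (H p).2).trans (cast_ncard_le (Set.inter_subset_inter_left Z
      ((nbhd_mono (Set.subset_insert a _)).trans Set.subset_union_right)))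
  choose K hKH hK hKe hK2 hK3 using fun p => h.exists_pruned_subset he hW hWZ
    ((hv p).insert_of_adj (hx p) (hxa p).symm) (hlarge p)
  have hKa : ∀ p, K p \ {a} ⊆ H p := fun p y hy => (hKH p hy.1).resolve_left hy.2
  refine ⟨a, K, ⟨hK, fun p p' hp => ?_⟩, fun p => ⟨?_, hKe p, hK2 p, hK3 p⟩⟩
  · exact (hF.pairwise (H p).2 (H p').2 (Subtype.coe_injective.ne (H.injective.ne hp))).mono
      (hKa p) (hKa p')
  · exact (hKH p).trans (Set.insert_subset (hF.base_subset ha) (hF.subset _ (H p).2))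

theorem SkeletonFamily.cons {a : Fin m → V} {K E : Fin m → ι → Set V} {a₀ : V} {K₀ E₀ : ι → Set V}
    (h : SkeletonFamily G ρ a K E) (h₀ : IsSkeleton G ρ a₀ K₀)
    (hE₀ : ∀ p, E₀ p ⊆ closedNbhd G (K₀ p) \ ⋃ p', K₀ p')
    (hK : ∀ p i p', Disjoint (closedNbhd G (K₀ p)) (K i p'))
    (hE : ∀ p i p', Disjoint (closedNbhd G (K₀ p)) (E i p')) :
    SkeletonFamily G ρ (Fin.cons a₀ a : Fin (m + 1) → V) (Fin.cons K₀ K : Fin (m + 1) → ι → Set V)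
      (Fin.cons E₀ E : Fin (m + 1) → ι → Set V) where
  isSkeleton := Fin.cases h₀ h.isSkeleton
  separated := by
    refine Fin.cases (Fin.cases (fun h => absurd rfl h) fun j _ p p' => ?_) fun i =>
      Fin.cases (fun _ p p' => ?_) fun j hij => h.separated i j fun hij' => hij (by rw [hij'])
    · exact separated_iff_disjoint_closedNbhd.2 (hK p j p')
    · exact (separated_iff_disjoint_closedNbhd.2 (hK p' i p)).symm
  attached := Fin.cases (fun p x hx => (hE₀ p hx).1.resolve_left fun hxK =>
    (hE₀ p hx).2 (Set.mem_iUnion_of_mem p hxK)) h.attached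
  disjoint := by
    refine Fin.cases (fun p => Fin.cases (fun p' => ?_) fun j p' => ?_) fun i p =>
      Fin.cases (fun p' => ?_) (h.disjoint i p)
    · exact Set.disjoint_left.2 fun x hx hxK => (hE₀ p hx).2 (Set.mem_iUnion_of_mem p' hxK)
    · exact (hK p j p').mono_left fun x hx => (hE₀ p hx).1
    · exact (hE p' i p).symm.mono_right Set.subset_union_left

theorem IsSparseCoherent.exists_skeletonFamily [Finite V] (h : IsSparseCoherent G α e)
    (hr : α ≤ (e / α) ^ r) (he : 1 ≤ e) (hW : 2 * e ≤ W) (hn : 1 ≤ n) (m : ℕ)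
    (hZ : (2 ^ 2 ^ (2 * n) + 3 * ((m : ℝ) - 1) * n) * W ≤ Z.ncard) :
    ∃ (a : Fin m → V) (K E : Fin m → Fin n → Set V), SkeletonFamily G (2 * r + 1) a K E ∧
      ∀ i p, K i p ⊆ Z ∧ E i p ⊆ Z ∧ 2 * W - 2 * n * e ≤ (E i p).ncard := by
  induction m generalizing Z with
  | zero => exact ⟨finZeroElim, finZeroElim, finZeroElim, ⟨finZeroElim, finZeroElim,
      finZeroElim, finZeroElim⟩, finZeroElim⟩
  | succ m ih =>
    push_cast at hZ
    have hmn : 0 ≤ m * n * W := mul_nonneg (by positivity) (by linarith)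
    obtain ⟨a₀, K₀, hK₀, hK₀Z⟩ := h.exists_isSkeleton (n := n) (Z := Z) hr he hW hn (by nlinarith)
    obtain ⟨U, hU⟩ : ∃ U, U = ⋃ p, closedNbhd G (K₀ p) ∩ Z := ⟨_, rfl⟩
    have hUcard : (U.ncard : ℝ) ≤ n * (3 * W) := by
      simpa [hU] using cast_ncard_iUnion_le fun p => (hK₀Z p).2.2.2
    obtain ⟨a, K, E, hKE, hsize⟩ := ih (Z := Z \ U)
      (by linarith [cast_ncard_sub_le_cast_ncard_sdiff Z U])
    have havoid : ∀ {p A}, A ⊆ Z \ U → Disjoint (closedNbhd G (K₀ p)) A := fun {p A} hA =>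
      Set.disjoint_left.2 fun x hx hxA =>
        (hA hxA).2 (hU ▸ Set.mem_iUnion_of_mem p ⟨hx, (hA hxA).1⟩)
    refine ⟨_, _, _, hKE.cons (E₀ := fun p => (closedNbhd G (K₀ p) ∩ Z) \ ⋃ p', K₀ p') hK₀
      (fun p => Set.sdiff_subset_sdiff_left Set.inter_subset_left)
      (fun p i p' => havoid (hsize i p').1) (fun p i p' => havoid (hsize i p').2.1),
      Fin.cases (fun p => ⟨(hK₀Z p).1, Set.sdiff_subset.trans Set.inter_subset_right, ?_⟩)
      fun i p => ⟨(hsize i p).1.trans Set.sdiff_subset,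
        (hsize i p).2.1.trans Set.sdiff_subset, (hsize i p).2.2⟩⟩
    have hK₀card : ((⋃ p, K₀ p).ncard : ℝ) ≤ n * (2 * e) := by
      simpa using cast_ncard_iUnion_le fun p => (hK₀Z p).2.1
    simp only [Fin.cons_zero]
    linarith [(hK₀Z p).2.2.1,
      cast_ncard_sub_le_cast_ncard_sdiff (closedNbhd G (K₀ p) ∩ Z) (⋃ p, K₀ p)]

end Skeleton

section Levelling

variable {V : Type*} {G : SimpleGraph V} {K B : Set V} {a x : V} {h i j : ℕ}

/-- The vertices at distance exactly `i` from `a` in the subgraph induced on `K ∪ {a}`. -/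
def layer (G : SimpleGraph V) (K : Set V) (a : V) (i : ℕ) : Set V :=
  {x | x ∈ ball G K a i ∧ ∀ j < i, x ∉ ball G K a j}

theorem layer_zero : layer G K a 0 = {a} := by simp [layer, ball]

theorem layer_subset (ha : a ∈ K) : layer G K a i ⊆ K := fun _ hx => ball_subset ha hx.1

theorem disjoint_layer (hij : i < j) : Disjoint (layer G K a i) (layer G K a j) :=
  Set.disjoint_left.2 fun _ hx hx' => hx'.2 i hij hx.1

theorem covers_layer (i : ℕ) : Covers G (layer G K a i) (layer G K a (i + 1)) := by
  rintro x ⟨hx, hx'⟩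
  rcases mem_ball_succ.1 hx with hx | ⟨hxK, y, hy, hyx⟩
  · exact absurd hx (hx' i i.lt_succ_self)
  · exact ⟨y, ⟨hy, fun j hj hyj => hx' (j + 1) (by omega) (Or.inr ⟨hxK, y, hyj, hyx⟩)⟩, hyx⟩

theorem anticomplete_layer (ha : a ∈ K) (hij : i + 2 ≤ j) :
    Anticomplete G (layer G K a i) (layer G K a j) := fun y hy _ hx hyx =>
  hx.2 (i + 1) (by omega) (Or.inr ⟨layer_subset ha hx, y, hy.1, hyx⟩)

/-- `B` is disjoint from `K`, and all its vertices have their nearest neighbours in `K` at distance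
exactly `h` from `a` in the subgraph induced on `K`. -/
structure IsAttached (G : SimpleGraph V) (K B : Set V) (a : V) (h : ℕ) : Prop where
  apex_mem : a ∈ K
  disjoint : Disjoint B K
  subset_nbhd : B ⊆ nbhd G (ball G K a h)
  far : ∀ i < h, Anticomplete G (ball G K a i) B

/-- The levels of the levelling formed by the first `h + 1` layers of `K`, followed by `B`. -/
def attachLevel (G : SimpleGraph V) (K B : Set V) (a : V) (h i : ℕ) : Set V :=
  if i ≤ h then layer G K a i else if i = h + 1 then B else ∅

theorem attachLevel_of_le (hi : i ≤ h) : attachLevel G K B a h i = layer G K a i := if_pos hi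

theorem attachLevel_succ : attachLevel G K B a h (h + 1) = B := by simp [attachLevel]

theorem attachLevel_of_lt (hi : h + 1 < i) : attachLevel G K B a h i = ∅ := by
  rw [attachLevel, if_neg (by omega), if_neg (by omega)]

namespace IsAttached

theorem disjoint_attachLevel (hB : IsAttached G K B a h) (hij : i < j) :
    Disjoint (attachLevel G K B a h i) (attachLevel G K B a h j) := by
  rcases lt_trichotomy j (h + 1) with hj | rfl | hj
  · rw [attachLevel_of_le (by omega), attachLevel_of_le (by omega)]
    exact disjoint_layer hij
  · rw [attachLevel_of_le (by omega), attachLevel_succ]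
    exact (hB.disjoint.mono_right (layer_subset hB.apex_mem)).symm
  · rw [attachLevel_of_lt hj]
    exact Set.disjoint_empty _

theorem covers_attachLevel (hB : IsAttached G K B a h) (hi : i ≤ h) :
    Covers G (attachLevel G K B a h i) (attachLevel G K B a h (i + 1)) := by
  rw [attachLevel_of_le hi]
  rcases hi.lt_or_eq with hi | rfl
  · rw [attachLevel_of_le hi]
    exact covers_layer i
  · rw [attachLevel_succ]
    intro x hx
    obtain ⟨y, hy, hyx⟩ := hB.subset_nbhd hx
    exact ⟨y, ⟨hy, fun j hj hyj => hB.far j hj y hyj x hx hyx⟩, hyx⟩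

theorem anticomplete_attachLevel (hB : IsAttached G K B a h) (hij : i + 2 ≤ j) (hj : j ≤ h + 1) :
    Anticomplete G (attachLevel G K B a h i) (attachLevel G K B a h j) := by
  rw [attachLevel_of_le (by omega)]
  rcases hj.lt_or_eq with hj | rfl
  · rw [attachLevel_of_le (by omega)]
    exact anticomplete_layer hB.apex_mem hij
  · rw [attachLevel_succ]
    exact fun y hy => hB.far i (by omega) y hy.1

/-- The levelling of height `h + 1` formed by the layers of `K` and the base `B`. -/
def levelling (hB : IsAttached G K B a h) : Levelling G where
  height := h + 1
  one_le_height := Nat.le_add_left 1 h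
  apex := a
  level := attachLevel G K B a h
  level_of_height_lt _ := attachLevel_of_lt
  level_zero := (attachLevel_of_le h.zero_le).trans layer_zero
  level_disjoint _ _ hij := (lt_or_gt_of_ne hij).elim hB.disjoint_attachLevel
    fun hji => (hB.disjoint_attachLevel hji).symm
  level_covers _ hi := hB.covers_attachLevel (Nat.le_of_lt_succ hi)
  level_anticomplete _ _ := hB.anticomplete_attachLevel

theorem base_levelling (hB : IsAttached G K B a h) : hB.levelling.base = B := attachLevel_succ

theorem mem_base_or_mem_layer (hB : IsAttached G K B a h) (hx : x ∈ hB.levelling.vertexSet) :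
    x ∈ B ∨ ∃ i ≤ h, x ∈ layer G K a i := by
  obtain ⟨i, hi, hx⟩ := hx
  rcases Nat.lt_or_ge h i with hlt | hge
  · obtain rfl : i = h + 1 := le_antisymm hi hlt
    exact Or.inl (attachLevel_succ.subset hx)
  · exact Or.inr ⟨i, hge, (attachLevel_of_le hge).subset hx⟩

theorem mem_layer_of_mem_heart (hB : IsAttached G K B a h) (hx : x ∈ hB.levelling.heart) :
    ∃ i ≤ h, x ∈ layer G K a i :=
  (hB.mem_base_or_mem_layer hx.1).resolve_left (hB.base_levelling ▸ hx.2)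

theorem heart_subset (hB : IsAttached G K B a h) : hB.levelling.heart ⊆ K := fun _ hx =>
  have ⟨_, _, hi⟩ := hB.mem_layer_of_mem_heart hx
  layer_subset hB.apex_mem hi

theorem vertexSet_subset (hB : IsAttached G K B a h) : hB.levelling.vertexSet ⊆ B ∪ K :=
  fun _ hx => (hB.mem_base_or_mem_layer hx).imp_right fun ⟨_, _, hi⟩ =>
    layer_subset hB.apex_mem hi

theorem mem_penultimate_or_mem_ball (hB : IsAttached G K B a h) (hx : x ∈ hB.levelling.heart) :
    x ∈ hB.levelling.penultimate ∨ ∃ i < h, x ∈ ball G K a i := by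
  obtain ⟨i, hi, hxi⟩ := hB.mem_layer_of_mem_heart hx
  rcases hi.lt_or_eq with hlt | rfl
  · exact Or.inr ⟨i, hlt, hxi.1⟩
  · exact Or.inl ((attachLevel_of_le (B := B) le_rfl).superset hxi)

theorem mem_ball_of_mem_inner (hB : IsAttached G K B a h) (hx : x ∈ hB.levelling.inner) :
    ∃ i < h, x ∈ ball G K a i := by
  obtain ⟨i, hi, hx⟩ := hx
  have hih : i < h := Nat.lt_of_succ_le (Nat.le_of_succ_le_succ hi)
  exact ⟨i, hih, ((attachLevel_of_le hih.le).subset hx).1⟩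

end IsAttached

end Levelling

section Lobster

variable {V : Type*} {G : SimpleGraph V} {m n ρ : ℕ} {e : ℝ}

theorem Lobster.height_le {T : Lobster G n} (hT : ∀ p, (T.member p).height ≤ ρ) :
    T.height ≤ ρ :=
  Finset.sup_le fun p _ => hT p

theorem Lobster.le_mass {T : Lobster G n} (hT : ∀ p, e ≤ (T.member p).base.ncard) :
    e ≤ T.mass := by
  have : Nonempty (Fin n) := ⟨⟨0, T.one_le_length⟩⟩
  obtain ⟨p, hp⟩ := exists_eq_ciInf_of_finite (f := fun p => (T.member p).base.ncard)
  exact (hT p).trans_eq (congrArg Nat.cast hp)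

/-- The lobster whose members are the levellings formed by the layers of the members of a skeleton
and the sets `B p` attached to them. -/
def IsSkeleton.lobster {a : V} {K B : Fin n → Set V} {h : Fin n → ℕ} (hK : IsSkeleton G ρ a K)
    (hn : 1 ≤ n) (hB : ∀ p, IsAttached G (K p) (B p) a (h p))
    (hfar : ∀ p p', ∀ i < h p, Anticomplete G (ball G (K p) a i) (B p')) : Lobster G n where
  one_le_length := hn
  apex := a
  member p := (hB p).levelling
  member_apex _ := rfl
  heart_disjoint p p' hp := (hK.separated p p' hp).1.mono
    (Set.sdiff_subset_sdiff_left (hB p).heart_subset)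
    (Set.sdiff_subset_sdiff_left (hB p').heart_subset)
  edge_condition p p' hp u hu v hv huv := by
    have huK : u ∈ K p \ {a} := ⟨(hB p).heart_subset hu.1, hu.2⟩
    have hvB : v ∈ B p' := ((hB p').vertexSet_subset hv.1).resolve_right fun hvK =>
      (hK.separated p p' hp).2 u huK v ⟨hvK, hv.2⟩ huv
    refine ⟨((hB p).mem_penultimate_or_mem_ball hu.1).resolve_right ?_,
      (hB p').base_levelling.superset hvB⟩
    rintro ⟨i, hi, hui⟩
    exact hfar p p' i hi u hui v hvB huv

variable {a : Fin m → V} {K D B : Fin m → Fin n → Set V} {h : Fin m → Fin n → ℕ}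

theorem SkeletonFamily.isTroupe_lobster (hK : SkeletonFamily G ρ a K D) (hn : 1 ≤ n)
    (hB : ∀ i p, IsAttached G (K i p) (B i p) (a i) (h i p))
    (hfar : ∀ i p j p', ∀ k < h i p, Anticomplete G (ball G (K i p) (a i) k) (B j p')) :
    IsTroupe fun i => (hK.isSkeleton i).lobster hn (hB i) fun p => hfar i p i where
  heart_disjoint i j hij := Set.disjoint_iUnion_left.2 fun p =>
    Set.disjoint_iUnion_right.2 fun p' =>
      (hK.separated i j hij p p').1.mono (hB i p).heart_subset (hB j p').heart_subset
  heart_anticomplete i j hij u hu v hv := by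
    obtain ⟨p, hup⟩ := Set.mem_iUnion.1 hu
    obtain ⟨p', hvp'⟩ := Set.mem_iUnion.1 hv
    exact (hK.separated i j hij p p').2 u ((hB i p).heart_subset hup) v
      ((hB j p').heart_subset hvp')
  inner_anticomplete i j p p' _ u hu v hv := by
    obtain ⟨k, hk, huk⟩ := (hB i p).mem_ball_of_mem_inner hu
    exact hfar i p j p' k hk u huk v ((hB j p').base_levelling.subset hv)

end Lobster

section Troupe

variable {V : Type*} {G : SimpleGraph V} {K : Set V} {a x : V} {m n ρ i : ℕ} {e : ℝ}

/-- The distance from `a`, in the subgraph induced on `K`, of the nearest neighbours of `x` in `K`,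
or `ρ + 1` if this distance is larger. -/
noncomputable def attachDist (G : SimpleGraph V) (K : Set V) (a : V) (ρ : ℕ) (x : V) : ℕ :=
  sInf {i | x ∈ nbhd G (ball G K a i) ∨ i = ρ + 1}

theorem attachDist_le : attachDist G K a ρ x ≤ ρ + 1 := Nat.sInf_le (Or.inr rfl)

theorem attachDist_le_of_mem (hx : x ∈ nbhd G (ball G K a i)) : attachDist G K a ρ x ≤ i :=
  Nat.sInf_le (Or.inl hx)

theorem mem_nbhd_of_attachDist_le (hx : attachDist G K a ρ x ≤ ρ) :
    x ∈ nbhd G (ball G K a (attachDist G K a ρ x)) :=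
  (Nat.sInf_mem (s := {i | x ∈ nbhd G (ball G K a i) ∨ i = ρ + 1}) ⟨_, Or.inr rfl⟩).resolve_right
    (show attachDist G K a ρ x ≠ ρ + 1 by omega)

theorem one_le_attachDist (hx : ¬ G.Adj a x) : 1 ≤ attachDist G K a ρ x := by
  by_contra! hlt
  obtain ⟨y, rfl, hyx⟩ : x ∈ nbhd G (ball G K a 0) :=
    Nat.lt_one_iff.1 hlt ▸ mem_nbhd_of_attachDist_le (by omega)
  exact hx hyx

/-- Each `B t` is a most common class of vertices `x` with given values of all the `δ s x`, chosen
to minimize the value of `δ t`. -/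
theorem exists_subsets_minimizing [Finite V] {σ β : Type*} [Fintype σ] [LinearOrder β]
    {D : σ → Set V} {δ : σ → V → β} {S : Finset β} (hS : S.Nonempty)
    (hδ : ∀ s, ∀ x ∈ D s, ∀ t, δ t x ∈ S) (he : 0 < e)
    (hD : ∀ s, S.card ^ Fintype.card σ * e ≤ (D s).ncard) :
    ∃ (B : σ → Set V) (h : σ → β), ∀ t, (∃ s, B t ⊆ D s) ∧ e ≤ (B t).ncard ∧
      (∀ x ∈ B t, δ t x = h t) ∧ (∀ s, ∀ x ∈ B s, h t ≤ δ t x) ∧ ∃ x ∈ D t, h t ≤ δ t x := by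
  classical
  choose c hc using fun s => exists_le_ncard_fiber (f := fun x t => δ t x)
    (s := Fintype.piFinset fun _ => S) (Fintype.piFinset_nonempty.2 fun _ => hS)
    (fun x hx => Fintype.mem_piFinset.2 (hδ s x hx)) (by simpa using hD s)
  choose τ hτ using fun t => have : Nonempty σ := ⟨t⟩; Finite.exists_min fun s => c s t
  refine ⟨fun t => D (τ t) ∩ (fun x t => δ t x) ⁻¹' {c (τ t)}, fun t => c (τ t) t, fun t =>
    ⟨⟨τ t, Set.inter_subset_left⟩, hc _, fun x hx => congrFun hx.2 t,
      fun s x hx => (hτ t (τ s)).trans_eq (congrFun hx.2 t).symm, ?_⟩⟩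
  obtain ⟨x, hxD, hx⟩ := Set.nonempty_of_ncard_ne_zero (Nat.cast_pos.1 (he.trans_le (hc t))).ne'
  exact ⟨x, hxD, (hτ t t).trans_eq (congrFun hx t).symm⟩

theorem SkeletonFamily.exists_isTroupe [Finite V] {a : Fin m → V} {K D : Fin m → Fin n → Set V}
    (hK : SkeletonFamily G ρ a K D) (hn : 1 ≤ n) (he : 0 < e)
    (ha : ∀ i p, Disjoint (D i p) (nbhd G (Set.range a)))
    (hD : ∀ i p, ((ρ : ℝ) + 1) ^ (m * n) * e ≤ (D i p).ncard) :
    ∃ T : Fin m → Lobster G n, IsTroupe T ∧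
      ∀ i, (T i).height ≤ ρ + 1 ∧ e ≤ (T i).mass := by
  obtain ⟨B, h, hBh⟩ := exists_subsets_minimizing (σ := Fin m × Fin n) (D := fun s => D s.1 s.2)
    (δ := fun t => attachDist G (K t.1 t.2) (a t.1) ρ) (S := Finset.Icc 1 (ρ + 1))
    (by simp) (fun s x hx t => Finset.mem_Icc.2 ⟨one_le_attachDist fun hax =>
      Set.disjoint_left.1 (ha s.1 s.2) hx ⟨a t.1, ⟨t.1, rfl⟩, hax⟩, attachDist_le⟩) he
    (fun s => by simpa using hD s.1 s.2)
  choose hBD hBe hBeq hBle hwit using hBh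
  have hle : ∀ t, h t ≤ ρ := fun t => by
    obtain ⟨x, hx, hxt⟩ := hwit t
    exact hxt.trans (attachDist_le_of_mem
      (nbhd_mono ((hK.isSkeleton t.1).radius t.2).subset_ball (hK.attached t.1 t.2 hx)))
  have hfar : ∀ t s, ∀ i < h t, Anticomplete G (ball G (K t.1 t.2) (a t.1) i) (B s) :=
    fun t s i hi y hy x hx hyx =>
      hi.not_ge ((hBle t s x hx).trans (attachDist_le_of_mem ⟨y, hy, hyx⟩))
  have hB : ∀ t, IsAttached G (K t.1 t.2) (B t) (a t.1) (h t) := fun t =>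
    { apex_mem := ((hK.isSkeleton t.1).radius t.2).center_mem
      disjoint := have ⟨s, hs⟩ := hBD t; (hK.disjoint s.1 s.2 t.1 t.2).mono_left hs
      subset_nbhd := fun x hx => hBeq t x hx ▸
        mem_nbhd_of_attachDist_le (ρ := ρ) (hBeq t x hx ▸ hle t)
      far := hfar t t }
  refine ⟨_, hK.isTroupe_lobster hn (fun i p => hB (i, p)) fun i p j p' => hfar (i, p) (j, p'),
    fun i => ⟨Lobster.height_le fun p => Nat.succ_le_succ (hle (i, p)),
      Lobster.le_mass fun p => ?_⟩⟩
  exact (hBe (i, p)).trans_eq (by rw [← (hB (i, p)).base_levelling]; rfl)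

end Troupe

section Assembly

variable {V : Type*} {G : SimpleGraph V} {α e : ℝ} {m n r ρ : ℕ}

theorem SkeletonFamily.mono {κ ι : Type*} {a : κ → V} {K D E : κ → ι → Set V}
    (h : SkeletonFamily G ρ a K E) (hDE : ∀ i p, D i p ⊆ E i p) :
    SkeletonFamily G ρ a K D where
  isSkeleton := h.isSkeleton
  separated := h.separated
  attached i p := (hDE i p).trans (h.attached i p)
  disjoint i p j p' := (h.disjoint i p j p').mono_left (hDE i p)

theorem sixteen_le_two_pow_two_pow_add (hm : 1 ≤ m) (hn : 1 ≤ n) :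
    (16 : ℝ) ≤ 2 ^ 2 ^ (2 * n) + 3 * ((m : ℝ) - 1) * n := by
  have hexp : 2 ^ 2 ≤ 2 ^ (2 * n) := Nat.pow_le_pow_right two_pos (by omega)
  have hpow : (2 : ℝ) ^ 4 ≤ 2 ^ 2 ^ (2 * n) := pow_le_pow_right₀ one_le_two hexp
  have hm1 : (0 : ℝ) ≤ m - 1 := sub_nonneg.2 (Nat.one_le_cast.2 hm)
  have hmn : 0 ≤ 3 * ((m : ℝ) - 1) * n := by positivity
  linarith

theorem two_mul_add_le_two_mul_add_two_pow (hr : r ≠ 0) (hm : 1 ≤ m) (hn : 1 ≤ n) :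
    2 * (n : ℝ) + m ≤ (2 * (r : ℝ) + 2) ^ (m * n) := by
  have hr' : (1 : ℝ) ≤ r := Nat.one_le_cast.2 (Nat.pos_of_ne_zero hr)
  have hm' : (1 : ℝ) ≤ m := Nat.one_le_cast.2 hm
  have hn' : (1 : ℝ) ≤ n := Nat.one_le_cast.2 hn
  calc 2 * (n : ℝ) + m ≤ 1 + ((m * n : ℕ) : ℝ) * 3 := by push_cast; nlinarith
    _ ≤ (1 + 3) ^ (m * n) := one_add_mul_le_pow (by norm_num) _
    _ ≤ (2 * (r : ℝ) + 2) ^ (m * n) := pow_le_pow_left₀ (by norm_num) (by linarith) _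

theorem IsSparseCoherent.exists_isTroupe [Finite V] (h : IsSparseCoherent G α e)
    (hr : α ≤ (e / α) ^ r) (he : 1 ≤ e) (hm : 1 ≤ m) (hn : 1 ≤ n)
    (hV : (2 ^ 2 ^ (2 * n) + 3 * ((m : ℝ) - 1) * n) * ((2 * (r : ℝ) + 2) ^ (m * n) * e) ≤
      Nat.card V) :
    ∃ T : Fin m → Lobster G n, IsTroupe T ∧ ∀ i, (T i).height ≤ 2 * r + 2 ∧ e ≤ (T i).mass := by
  obtain ⟨W, hWdef⟩ : ∃ W, W = (2 * (r : ℝ) + 2) ^ (m * n) * e := ⟨_, rfl⟩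
  rw [← hWdef] at hV
  have heW : e ≤ W := hWdef ▸ le_mul_of_one_le_left (by linarith)
    (one_le_pow₀ (by linarith [r.cast_nonneg (α := ℝ)]))
  have h16W : 16 * W ≤ Nat.card V := (mul_le_mul_of_nonneg_right
    (sixteen_le_two_pow_two_pow_add hm hn) (by linarith)).trans hV
  have hr0 : r ≠ 0 := by
    rintro rfl
    exact (h.one_lt he (by linarith)).not_ge (by simpa using hr)
  have hmnW : (2 * (n : ℝ) + m) * e ≤ W := hWdef ▸
    mul_le_mul_of_nonneg_right (two_mul_add_le_two_mul_add_two_pow hr0 hm hn) (by linarith)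
  have h2W : 2 * e ≤ W := le_trans (mul_le_mul_of_nonneg_right
    (by exact_mod_cast (by omega : 2 ≤ 2 * n + m)) (by linarith)) hmnW
  obtain ⟨a, K, E, hK, hE⟩ := h.exists_skeletonFamily (Z := Set.univ) hr he h2W hn m
    (by rwa [Set.ncard_univ])
  have hρ : ((2 * r + 1 : ℕ) : ℝ) + 1 = 2 * r + 2 := by push_cast; ring
  refine (hK.mono (D := fun i p => E i p \ nbhd G (Set.range a))
    fun i p => Set.sdiff_subset).exists_isTroupe hn (by linarith)
    (fun i p => Set.disjoint_sdiff_left) fun i p => ?_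
  have hnbhd := h.ncard_nbhd_range_le a
  rw [Fintype.card_fin] at hnbhd
  rw [hρ, ← hWdef]
  linarith [cast_ncard_sub_le_cast_ncard_sdiff (E i p) (nbhd G (Set.range a)), (hE i p).2.2]

theorem IsSparse.isSparseCoherent {ε : ℝ} (h : IsSparse G ε)
    (hcoherent : IsCoherent G α (ε * Nat.card V)) (hpos : 0 < α) (hle : α ≤ ε * Nat.card V) :
    IsSparseCoherent G α (ε * Nat.card V) where
  pos := hpos
  le := hle
  ncard_neighborSet_lt := h
  ncard_lt_of_separated A B hAB hA := by
    by_contra! hB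
    exact hcoherent ⟨A, B, hAB.1, hAB.2, hA, hB⟩

theorem mul_rpow_one_sub_le_div_pow_floor {c ε x : ℝ} (hc : 0 < c) (hε₀ : 0 < ε) (hε₁ : ε ≤ 1)
    (hx : 1 ≤ x) : ε * x ^ (1 - c) ≤ (ε * x / (ε * x ^ (1 - c))) ^ ⌊1 / c⌋₊ := by
  have hx₀ : 0 < x := by linarith
  have hfloor : 1 - c ≤ c * ⌊1 / c⌋₊ := by
    have hlt := (div_lt_iff₀ hc).1 (Nat.lt_floor_add_one (1 / c))
    linarith
  calc ε * x ^ (1 - c) ≤ x ^ (1 - c) := mul_le_of_le_one_left (by positivity) hε₁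
    _ ≤ x ^ (c * ⌊1 / c⌋₊) := Real.rpow_le_rpow_of_exponent_le hx hfloor
    _ = (x ^ c) ^ ⌊1 / c⌋₊ := Real.rpow_mul_natCast hx₀.le c _
    _ = (ε * x / (ε * x ^ (1 - c))) ^ ⌊1 / c⌋₊ := by
      rw [mul_div_mul_left _ _ hε₀.ne', Real.rpow_sub hx₀, Real.rpow_one, div_div_cancel₀ hx₀.ne']

end Assembly

end PurePairs

theorem mainTheorem8_general {V : Type*} [Finite V] (G : SimpleGraph V) (hG : 1 < Nat.card V)
    (c : ℝ) (hc : 0 < c) (m n : ℕ) (hm : 1 ≤ m) (hn : 1 ≤ n) (ε : ℝ)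
    (hε : ε⁻¹ = ((2 : ℝ) ^ (2 ^ (2 * n)) + 3 * ((m : ℝ) - 1) * (n : ℝ)) *
      (2 + 2 / c) ^ (m * n))
    (hsparse : PurePairs.IsSparse G ε)
    (hcoherent : PurePairs.IsCoherent G
      (ε * (Nat.card V : ℝ) ^ (1 - c)) (ε * (Nat.card V : ℝ))) :
    ∃ T : Fin m → PurePairs.Lobster G n,
      PurePairs.IsTroupe T ∧
      ∀ i, ((T i).height : ℝ) ≤ 2 + 2 / c ∧ ε * (Nat.card V : ℝ) ≤ ((T i).mass : ℝ) := by
  have : Nontrivial V := Finite.one_lt_card_iff_nontrivial.1 hG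
  have hV : (1 : ℝ) ≤ Nat.card V := Nat.one_le_cast.2 hG.le
  have hfactor := PurePairs.sixteen_le_two_pow_two_pow_add hm hn
  have hinv : 1 ≤ ε⁻¹ := hε ▸ one_le_mul_of_one_le_of_one_le (by linarith)
    (one_le_pow₀ (by linarith [div_pos two_pos hc]))
  have hε₀ : 0 < ε := inv_pos.1 (by linarith)
  have hheight : 2 * (⌊1 / c⌋₊ : ℝ) + 2 ≤ 2 + 2 / c := by
    linarith [Nat.floor_le (one_div_pos.2 hc).le, mul_one_div 2 c]
  have h := hsparse.isSparseCoherent hcoherent (by positivity) (mul_le_mul_of_nonneg_left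
    (Real.rpow_le_self_of_one_le hV (by linarith)) hε₀.le)
  obtain ⟨T, hT, hbound⟩ := h.exists_isTroupe (m := m) (n := n)
    (PurePairs.mul_rpow_one_sub_le_div_pow_floor hc hε₀ ((one_le_inv₀ hε₀).1 hinv) hV)
    h.one_le hm hn (by
      rw [← mul_assoc]
      calc _ ≤ ε⁻¹ * (ε * Nat.card V) := hε ▸ by gcongr
        _ = Nat.card V := inv_mul_cancel_left₀ hε₀.ne' _)
  exact ⟨T, hT, fun i => ⟨le_trans (by exact_mod_cast (hbound i).1) hheight, (hbound i).2⟩⟩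

theorem mainTheorem8 {V : Type*} [Finite V] (G : SimpleGraph V) (hG : 1 < Nat.card V)
    (c : ℝ) (hc : 0 < c) (hc_int : ∃ k : ℤ, 1 / c = (k : ℝ))
    (m n : ℕ) (hm : 1 ≤ m) (hn : 1 ≤ n)
    (ε : ℝ)
    (hε : ε⁻¹ = ((2 : ℝ) ^ (2 ^ (2 * n)) + 3 * ((m : ℝ) - 1) * (n : ℝ)) *
      (2 + 2 / c) ^ (m * n))
    (hsparse : PurePairs.IsSparse G ε)
    (hcoherent : PurePairs.IsCoherent G
      (ε * (Nat.card V : ℝ) ^ (1 - c)) (ε * (Nat.card V : ℝ))) :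
    ∃ T : Fin m → PurePairs.Lobster G n,
      PurePairs.IsTroupe T ∧
      ∀ i, ((T i).height : ℝ) ≤ 2 + 2 / c ∧ ε * (Nat.card V : ℝ) ≤ ((T i).mass : ℝ) :=
  mainTheorem8_general G hG c hc m n hm hn ε hε hsparse hcoherent
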